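/- **Setting.** Structures are non-empty. Let $\Pi_0=(\Sigma_0,\mathsf{Pred})$ be a signature, $\Sigma_P$ (parameters) and $\Sigma$ (extension functions) sets of new function symbols, disjoint from each other and from $\Sigma_0$; constants are $0$-ary function symbols and $\Sigma$ contains only finitely many constants. Let $\Pi_P=\Pi_0\cup\Sigma_P$, $\Pi=\Pi_P\cup\Sigma$, and let $\Pi^C$ be $\Pi$ with a non-empty set $C$ of fresh constants. Let $\mathcal T_0$ be a $\Pi_0$-theory that allows quantifier elimination: every $\Pi_0$-formula is equivalent modulo $\mathcal T_0$ to a quantifier-free one in the same free variables. Let $\mathcal K$ be a set of (universally closed) $\Pi$-clauses. A $\Sigma$-term is a term that starts with a symbol of $\Sigma$. Assume: * every variable of a clause of $\mathcal K$ occurs in a $\Sigma$-term of this clause; * $\mathcal K$ is flat: in a non-ground (resp. ground) clause of $\mathcal K$, only variables (resp. only constants) occur below symbols of $\Sigma$; * $\mathcal K$ is linear: if a variable (resp., in a ground clause, a constant) occurs in two $\Sigma$-terms of a clause of $\mathcal K$, these terms are equal, and no $\Sigma$-term contains it twice; * $(\mathsf{Comp}_f)$: let $A$ be a structure in which $\Pi_P$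 is interpreted by total functions and relations and $\Sigma$ by partial functions, with constants defined, such that the $\Pi_0$-reduct of $A$ is a model of $\mathcal T_0$, the set of all pairs $(g,\bar a)$ with $g\in\Sigma$ and $g_A(\bar a)$ defined is finite, all ground $\Sigma$-terms occurring in $\mathcal K$ are defined, and $A$ weakly satisfies $\mathcal K$ (for every clause of $\mathcal K$ and every assignment, some literal of the clause is undefined or some literal is defined and true). Then there is a total model of $\mathcal T_0\cup\mathcal K$ with the same universe and the same interpretation of $\Pi_P$ in which the functions of $\Sigma$ extend those of $A$. Let $G$ be a finite set of ground $\Pi^C$-clauses, let $T=\mathrm{est}(\mathcal K,G)$ be the set of ground $\Sigma$-terms occurring in $\mathcal K$ or $G$, and let $\mathcal K[T]$ be the set of ground instances of clauses of $\mathcal K$ all of whose $\Sigma$-terms lie in $T$. Assume that $\mathcal K[T]$ is finite (this holds if $\mathcal K$ is finite). **The constraint $\forall\bar y\,\Gamma_G(\bar y)$.** (1) Flatten and purify $\mathcal K[T]\cup G$ with respect to $\Sigma_P\cup\Sigma$: for each term $t=f(t_1,\dots,t_n)$ with $f\in\Sigma_P\cup\Sigma$ that occurs in $\mathcal K[T]\cup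 G$, introduce constants $c_t,c_{t_1},\dots,c_{t_n}$ (a constant in $C$ names itself), with the definition $c_t\approx f(c_{t_1},\dots,c_{t_n})$; replace these terms by their names, and if an argument $t_i$ starts with a symbol of $\Sigma_0$, add the equation $c_{t_i}\approx t_i$ with $t_i$ purified. Let $G_1$ consist of the resulting $\Pi_0$-clauses and of the clauses $c_{s_1}\approx c_{t_1}\wedge\dots\wedge c_{s_n}\approx c_{t_n}\to c_s\approx c_t$ for all pairs of definitions $c_s\approx f(c_{s_1},\dots,c_{s_n})$, $c_t\approx f(c_{t_1},\dots,c_{t_n})$ with the same $f$. (2) Let $\bar c_f$ be the names $c_t$ of the terms $t$ that start with a parameter, $\bar c_p$ the names of the arguments of these terms, and turn all remaining names into existentially quantified variables $\bar x$. (3) Let $\Gamma_1(\bar c_p,\bar c_f)$ be a quantifier-free $\Pi_0$-formula equivalent modulo $\mathcal T_0$ to $\exists\bar x\,\bigwedge G_1(\bar c_p,\bar c_f,\bar x)$. (4) Let $\Gamma_2$ be obtained from $\Gamma_1$ by replacing (repeatedly) the constants in $\bar c_f$ by the terms $f(\dots)$ that define them; replace the remaining constants $\bar c_p$ by variables $\bar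 y$. (5) Let $\forall\bar y\,\Gamma_G(\bar y)$ be $\forall\bar y\,\neg\Gamma_2(\bar y)$, a universal $\Pi_P$-sentence. **Claim.** A formula $\Gamma_1$ as in (3) exists, and for each such choice the resulting sentence $\forall\bar y\,\Gamma_G(\bar y)$ is the weakest constraint on the parameters that makes $G$ unsatisfiable, that is: * $\mathcal T_0\cup\{\forall\bar y\,\Gamma_G(\bar y)\}\cup\mathcal K\cup G$ is unsatisfiable; * for every set $\Gamma$ of (universally closed) $\Pi_P$-clauses such that $\mathcal T_0\cup\Gamma\cup\mathcal K\cup G$ is unsatisfiable, $\mathcal T_0\cup\Gamma\models\forall\bar y\,\Gamma_G(\bar y)$. -/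

import Mathlib

open FirstOrder FirstOrder.Language

universe u v w

namespace SymbolElimination

/-! ### Signatures -/

/-- The signature obtained from `L` by adding a family `F` of new function symbols
(`F n` is the set of the new `n`-ary symbols); the predicate symbols stay the same. -/
def addFun (L : FirstOrder.Language.{u, u}) (F : ℕ → Type u) : FirstOrder.Language.{u, u} where
  Functions n := L.Functions n ⊕ F n
  Relations n := L.Relations n

/-- The inclusion of a signature in its extension by new function symbols. -/
def inclFun (L : FirstOrder.Language.{u, u}) (F : ℕ → Type u) : L →ᴸ addFun L F where
  onFunction _ f := Sum.inl f
  onRelation _ R := R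

/-! ### Terms, literals, clauses -/

/-- The set of all subterms of a term (the term itself included). -/
def subterms {L : FirstOrder.Language.{u, u}} {X : Type v} : L.Term X → Set (L.Term X)
  | .var x => {.var x}
  | .func f ts => {.func f ts} ∪ ⋃ i, subterms (ts i)

open Classical in
/-- The number of occurrences of the term `s` as a subterm of a term. -/
noncomputable def occurrences {L : FirstOrder.Language.{u, u}} {X : Type v} (s : L.Term X) :
    L.Term X → ℕ
  | .var x => if s = .var x then 1 else 0
  | .func f ts => (if s = .func f ts then 1 else 0) + ∑ i, occurrences s (ts i)

/-- Literals: equalities `s ≈ t` and atoms `R(ts)`, positive (`true`) or negated (`false`). -/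
inductive Lit (L : FirstOrder.Language.{u, u}) (X : Type v) : Type (max u v)
  | eq (pos : Bool) (s t : L.Term X) : Lit L X
  | rel (pos : Bool) {n : ℕ} (R : L.Relations n) (ts : Fin n → L.Term X) : Lit L X

/-- A clause is a finite disjunction of literals. -/
abbrev Clause (L : FirstOrder.Language.{u, u}) (X : Type v) : Type (max u v) := List (Lit L X)

/-- The first-order formula expressed by a literal. -/
def Lit.toFormula {L : FirstOrder.Language.{u, u}} {X : Type v} : Lit L X → L.Formula X
  | .eq true s t => s.equal t
  | .eq false s t => (s.equal t).not
  | .rel true R ts => R.formula ts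
  | .rel false R ts => (R.formula ts).not

/-- The (quantifier-free) formula expressed by a clause: the disjunction of its literals. -/
def clauseFormula {L : FirstOrder.Language.{u, u}} {X : Type v} (D : Clause L X) : L.Formula X :=
  (D.map Lit.toFormula).foldr (fun φ ψ => φ ⊔ ψ) ⊥

/-- The conjunction of a finite list of clauses. -/
def conjFormula {L : FirstOrder.Language.{u, u}} {X : Type v} (l : List (Clause L X)) : L.Formula X :=
  (l.map clauseFormula).foldr (fun φ ψ => φ ⊓ ψ) ⊤

/-- Apply a substitution to a literal. -/
def Lit.subst {L : FirstOrder.Language.{u, u}} {X : Type v} {Y : Type w} (σ : X → L.Term Y) :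
    Lit L X → Lit L Y
  | .eq b s t => .eq b (s.subst σ) (t.subst σ)
  | .rel b R ts => .rel b R fun i => (ts i).subst σ

/-- Apply a substitution to a clause. -/
def clauseSubst {L : FirstOrder.Language.{u, u}} {X : Type v} {Y : Type w} (σ : X → L.Term Y)
    (D : Clause L X) : Clause L Y :=
  D.map (Lit.subst σ)

/-- The terms that occur in a literal, at any depth. -/
def Lit.terms {L : FirstOrder.Language.{u, u}} {X : Type v} : Lit L X → Set (L.Term X)
  | .eq _ s t => subterms s ∪ subterms t
  | .rel _ _ ts => ⋃ i, subterms (ts i)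

/-- The terms that occur in a clause, at any depth. -/
def clauseTerms {L : FirstOrder.Language.{u, u}} {X : Type v} (D : Clause L X) : Set (L.Term X) :=
  {t | ∃ l ∈ D, t ∈ Lit.terms l}

/-- The universal closure of a formula. -/
noncomputable def allClosure {L : FirstOrder.Language.{u, u}} {X : Type v} (φ : L.Formula X) :
    L.Sentence :=
  haveI : DecidableEq X := Classical.decEq X
  Formula.iAlls φ.freeVarFinset (Formula.relabel Sum.inr (φ.restrictFreeVar id))

/-- Existential quantification over all free variables of `φ` that do not lie in `A`. -/
noncomputable def exOutside {L : FirstOrder.Language.{u, u}} {X : Type v} (A : Set X) (φ : L.Formula X) :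
    L.Formula A :=
  haveI : DecidableEq X := Classical.decEq X
  haveI : DecidablePred (· ∈ A) := Classical.decPred _
  Formula.iExs φ.freeVarFinset
    (φ.restrictFreeVar fun x => if h : x.1 ∈ A then Sum.inl ⟨x.1, h⟩ else Sum.inr x)

/-- The theory that consists of the universal closures of a set of clauses. -/
def clauseTheory {L : FirstOrder.Language.{u, u}} {X : Type v} (K : Set (Clause L X)) : L.Theory :=
  {φ | ∃ D ∈ K, φ = allClosure (clauseFormula D)}

/-- A theory has quantifier elimination: modulo the theory, every formula is equivalent to a
quantifier-free formula in the same free variables. -/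
def HasQE {L : FirstOrder.Language.{u, u}} (T : L.Theory) : Prop :=
  ∀ (n : ℕ) (φ : L.Formula (Fin n)),
    ∃ ψ : L.Formula (Fin n), BoundedFormula.IsQF ψ ∧ (φ ⇔[T] ψ)

/-! ### Theory extensions

`L₀` is the base signature, `P` the family of parameters, `S` the family of the remaining
extension functions.  Constants are the `0`-ary function symbols. -/

/-- The signature of base symbols and parameters. -/
abbrev sigP (L₀ : FirstOrder.Language.{u, u}) (P : ℕ → Type u) : FirstOrder.Language.{u, u} := addFun L₀ P

/-- The full signature: base symbols, parameters, extension functions. -/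
abbrev sig (L₀ : FirstOrder.Language.{u, u}) (P S : ℕ → Type u) : FirstOrder.Language.{u, u} := addFun (sigP L₀ P) S

section

variable {L₀ : FirstOrder.Language.{u, u}} {P S : ℕ → Type u}

/-- A term that starts with an extension function. -/
def IsExt {X : Type v} (t : (sig L₀ P S).Term X) : Prop :=
  ∃ (n : ℕ) (f : S n) (ts : Fin n → (sig L₀ P S).Term X), t = .func (Sum.inr f) ts

/-- A term that starts with a parameter. -/
def IsPar {X : Type v} (t : (sig L₀ P S).Term X) : Prop :=
  ∃ (n : ℕ) (p : P n) (ts : Fin n → (sig L₀ P S).Term X), t = .func (Sum.inl (Sum.inr p)) ts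

/-- `s` is an immediate argument of `t`. -/
def IsArg {L : FirstOrder.Language.{u, u}} {X : Type v} (s t : L.Term X) : Prop :=
  ∃ (n : ℕ) (f : L.Functions n) (ts : Fin n → L.Term X) (i : Fin n),
    t = .func f ts ∧ s = ts i

/-- A constant of the signature, as a term. -/
def IsConst {L : FirstOrder.Language.{u, u}} {X : Type v} (t : L.Term X) : Prop :=
  ∃ (c : L.Functions 0) (ts : Fin 0 → L.Term X), t = .func c ts

/-- A clause without variables. -/
def IsGround {L : FirstOrder.Language.{u, u}} {X : Type v} (D : Clause L X) : Prop :=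
  ∀ x : X, Term.var x ∉ clauseTerms D

/-- A ground clause is flat if only constants occur below extension functions, a non-ground clause
if only variables do. -/
def IsFlat {X : Type v} (D : Clause (sig L₀ P S) X) : Prop :=
  (IsGround D → ∀ t ∈ clauseTerms D, IsExt t → ∀ s, IsArg s t → IsConst s) ∧
  (¬ IsGround D → ∀ t ∈ clauseTerms D, IsExt t → ∀ s, IsArg s t → ∃ x, s = .var x)

/-- The terms in `A` (variables or constants) occur at most once in every term of `D` that starts
with an extension function, and in at most one such term. -/
def LinearIn {X : Type v} (A : Set ((sig L₀ P S).Term X)) (D : Clause (sig L₀ P S) X) : Prop :=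
  (∀ a ∈ A, ∀ s ∈ clauseTerms D, ∀ t ∈ clauseTerms D, IsExt s → IsExt t →
    a ∈ subterms s → a ∈ subterms t → s = t) ∧
  (∀ a ∈ A, ∀ t ∈ clauseTerms D, IsExt t → occurrences a t ≤ 1)

/-- Linearity, with respect to constants for a ground clause and with respect to variables for a
non-ground one. -/
def IsLinear {X : Type v} (D : Clause (sig L₀ P S) X) : Prop :=
  (IsGround D → LinearIn {a | IsConst a} D) ∧
  (¬ IsGround D → LinearIn {a | ∃ x, a = .var x} D)

/-- Every variable of `D` occurs (also) below an extension function in `D`. -/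
def VarsBelowExt {X : Type v} (D : Clause (sig L₀ P S) X) : Prop :=
  ∀ x : X, Term.var x ∈ clauseTerms D →
    ∃ t ∈ clauseTerms D, IsExt t ∧ Term.var x ∈ subterms t

/-- The ground terms (terms without variables) that start with an extension function and occur in
`K`. -/
def extGroundTerms {X : Type v} (K : Set (Clause (sig L₀ P S) X)) :
    Set ((sig L₀ P S).Term Empty) :=
  {t | IsExt t ∧ ∃ D ∈ K, t.relabel Empty.elim ∈ clauseTerms D}

/-! #### Partial structures and the completability condition -/

/-- A partial structure over a total structure `M` for base symbols and parameters: the extension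
functions are partial, the extension constants are defined. -/
structure PartialExt (S : ℕ → Type u) (M : Type u) where
  /-- the partial functions that interpret the extension functions -/
  fn : ∀ {n : ℕ}, S n → (Fin n → M) → Part M
  /-- constants are always defined -/
  const_dom : ∀ (c : S 0) (a : Fin 0 → M), (fn c a).Dom

/-- Evaluation of a term in a partial structure under an assignment `β`: undefined as soon as an
argument is undefined or the tuple of arguments is outside the domain of the function. -/
def PartialExt.eval {M : Type u} [(sigP L₀ P).Structure M] (A : PartialExt S M) {X : Type v}
    (β : X → M) : (sig L₀ P S).Term X → Part M
  | .var x => Part.some (β x)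
  | .func f ts =>
    (Part.mk (∀ i, (A.eval β (ts i)).Dom) fun h i => (A.eval β (ts i)).get (h i)).bind fun a =>
      Sum.elim (fun g : (sigP L₀ P).Functions _ => Part.some (Structure.funMap g a))
        (fun g : S _ => A.fn g a) f

/-- All terms of the literal are defined under `β`. -/
def PartialExt.LitDefined {M : Type u} [(sigP L₀ P).Structure M] (A : PartialExt S M)
    {X : Type v} (β : X → M) : Lit (sig L₀ P S) X → Prop
  | .eq _ s t => (A.eval β s).Dom ∧ (A.eval β t).Dom
  | .rel _ _ ts => ∀ i, (A.eval β (ts i)).Dom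

/-- The literal is defined and true under `β`. -/
def PartialExt.LitTrue {M : Type u} [(sigP L₀ P).Structure M] (A : PartialExt S M)
    {X : Type v} (β : X → M) : Lit (sig L₀ P S) X → Prop
  | .eq b s t => ∃ x ∈ A.eval β s, ∃ y ∈ A.eval β t, (b = true ↔ x = y)
  | .rel b (n := n) R ts => ∃ a : Fin n → M, (∀ i, a i ∈ A.eval β (ts i)) ∧
      (b = true ↔ Structure.RelMap (L := sigP L₀ P) (show (sigP L₀ P).Relations n from R) a)

/-- Weak validity: for every assignment, some literal is undefined, or all are defined and at least
one is true. -/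
def PartialExt.WeaklySatisfies {M : Type u} [(sigP L₀ P).Structure M] (A : PartialExt S M)
    {X : Type v} (D : Clause (sig L₀ P S) X) : Prop :=
  ∀ β : X → M, (∃ l ∈ D, ¬ A.LitDefined β l) ∨
    ((∀ l ∈ D, A.LitDefined β l) ∧ ∃ l ∈ D, A.LitTrue β l)

/-- The class of partial structures in the completability condition: `M` is a total model of `T₀`
(with total parameters), `A` weakly satisfies `K`, the extension functions are defined at finitely
many places only, and every extension ground term that occurs in `K` is defined. -/
structure IsWeakPartialModel (T₀ : L₀.Theory) {X : Type v} (K : Set (Clause (sig L₀ P S) X))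
    (M : Type u) [(sigP L₀ P).Structure M] (A : PartialExt S M) : Prop where
  base : M ⊨ (inclFun L₀ P).onTheory T₀
  weak : ∀ D ∈ K, A.WeaklySatisfies D
  finite : {q : Σ n : ℕ, S n × (Fin n → M) | (A.fn q.2.1 q.2.2).Dom}.Finite
  ground : ∀ t ∈ extGroundTerms K, (A.eval Empty.elim t).Dom

/-- The theory `T₀ ∪ Φ ∪ K` in the full signature, where `Φ` is a set of sentences about base
symbols and parameters and the clauses in `K` are universally closed. -/
def extTheory (T₀ : L₀.Theory) (Φ : (sigP L₀ P).Theory) {X : Type v}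
    (K : Set (Clause (sig L₀ P S) X)) : (sig L₀ P S).Theory :=
  (inclFun (sigP L₀ P) S).onTheory ((inclFun L₀ P).onTheory T₀ ∪ Φ) ∪ clauseTheory K

/-- The completability condition: every such partial structure can be completed to a total model
of `T₀ ∪ K` on the same support, in which base symbols and parameters are interpreted as before and
the extension functions extend the given partial functions. -/
def Comp (T₀ : L₀.Theory) {X : Type v} (K : Set (Clause (sig L₀ P S) X)) : Prop :=
  ∀ (M : Type u) [Nonempty M] [(sigP L₀ P).Structure M] (A : PartialExt S M),
    IsWeakPartialModel T₀ K M A →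
    ∃ B : (sig L₀ P S).Structure M,
      (∀ (n : ℕ) (f : (sigP L₀ P).Functions n) (a : Fin n → M),
        B.funMap (Sum.inl f) a = Structure.funMap f a) ∧
      (∀ (n : ℕ) (R : (sigP L₀ P).Relations n) (a : Fin n → M),
        B.RelMap R a ↔ Structure.RelMap R a) ∧
      (∀ (n : ℕ) (f : S n) (a : Fin n → M), ∀ b ∈ A.fn f a, B.funMap (Sum.inr f) a = b) ∧
      M ⊨ extTheory T₀ ∅ K

/-! #### Instances

Ground terms over the full signature with a set `C` of fresh constants are represented as terms
with variables in `C`; ground clauses accordingly. -/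

/-- `est(K, G)`: the ground terms that start with an extension function and occur in `G` or `K`. -/
def est {X : Type v} {C : Type u} (K : Set (Clause (sig L₀ P S) X))
    (G : Set (Clause (sig L₀ P S) C)) : Set ((sig L₀ P S).Term C) :=
  {t | IsExt t ∧ ∃ D ∈ G, t ∈ clauseTerms D} ∪
    {t | ∃ t₀ ∈ extGroundTerms K, t = t₀.relabel Empty.elim}

/-- `K[T]`: the ground instances of clauses of `K` in which all terms that start with an extension
function are in `T`. (In the clauses to which this is applied, all variables occur below extension
functions, so that no variable has to be left uninstantiated.) -/
def inst {X : Type v} {C : Type u} (K : Set (Clause (sig L₀ P S) X))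
    (T : Set ((sig L₀ P S).Term C)) : Set (Clause (sig L₀ P S) C) :=
  {D' | ∃ D ∈ K, ∃ σ : X → (sig L₀ P S).Term C, D' = clauseSubst σ D ∧
    ∀ t ∈ clauseTerms D', IsExt t → t ∈ T}

/-- The constants in `C` are added to the signature and the elements of `G` are read as sentences
over it: satisfiability of `T₀ ∪ Φ ∪ K ∪ G`. -/
def SatWith {C : Type u} (T₀ : L₀.Theory) (Φ : (sigP L₀ P).Theory) {X : Type v}
    (K : Set (Clause (sig L₀ P S) X)) (G : Set (Clause (sig L₀ P S) C)) : Prop :=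
  Theory.IsSatisfiable (((sig L₀ P S).lhomWithConstants C).onTheory (extTheory T₀ Φ K) ∪
    {φ | ∃ D ∈ G, φ = Formula.equivSentence (clauseFormula D)})

/-! #### Flattening and purification

The name of a ground term `t` is the constant `c_t`; here the index `t` itself is used as name, and
a constant in `C` is its own name. The terms that are named are those that start with a parameter
or an extension function, their arguments, and the constants in `C`. -/

/-- Replace all maximal subterms that start with a parameter or extension function by their
names. The result is a base term. -/
def purify {C : Type u} : (sig L₀ P S).Term C → L₀.Term ((sig L₀ P S).Term C)
  | .var c => .var (.var c)
  | .func f ts =>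
    Sum.elim
      (Sum.elim (fun g : L₀.Functions _ => .func g fun i => purify (ts i))
        fun p : P _ => .var (.func (Sum.inl (Sum.inr p)) ts))
      (fun g : S _ => .var (.func (Sum.inr g) ts)) f

/-- Purification of a literal. -/
def purifyLit {C : Type u} : Lit (sig L₀ P S) C → Lit L₀ ((sig L₀ P S).Term C)
  | .eq b s t => .eq b (purify s) (purify t)
  | .rel b (n := n) R ts => .rel b (show L₀.Relations n from R) fun i => purify (ts i)

/-- The terms starting with a parameter or an extension function that occur in `N`. The set `Def`
consists of the definitions `c_t ≈ f(c_{t₁}, …, c_{tₙ})` for these terms `t = f(t₁, …, tₙ)`. -/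
def defTerms {C : Type u} (N : Set (Clause (sig L₀ P S) C)) : Set ((sig L₀ P S).Term C) :=
  {t | (IsPar t ∨ IsExt t) ∧ ∃ D ∈ N, t ∈ clauseTerms D}

/-- The purified clauses, together with an equation `c_s ≈ s` for every argument `s` of a defined
term (a triviality `c_s ≈ c_s` unless `s` starts with a base symbol). -/
def purified {C : Type u} (N : Set (Clause (sig L₀ P S) C)) :
    Set (Clause L₀ ((sig L₀ P S).Term C)) :=
  {D' | ∃ D ∈ N, D' = D.map purifyLit} ∪
    {D' | ∃ t ∈ defTerms N, ∃ s, IsArg s t ∧ D' = [.eq true (.var s) (purify s)]}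

/-- `Con₀`: the clauses `c_{s₁} ≈ c_{t₁} ∧ … ∧ c_{sₙ} ≈ c_{tₙ} → c_s ≈ c_t` for all defined terms
`s = f(s₁, …, sₙ)` and `t = f(t₁, …, tₙ)`. -/
def con {C : Type u} (N : Set (Clause (sig L₀ P S) C)) :
    Set (Clause L₀ ((sig L₀ P S).Term C)) :=
  {D' | ∃ (n : ℕ) (f : (sig L₀ P S).Functions n) (ss ts : Fin n → (sig L₀ P S).Term C),
    Term.func f ss ∈ defTerms N ∧ Term.func f ts ∈ defTerms N ∧
    D' = (List.ofFn fun i => Lit.eq false (.var (ss i)) (.var (ts i))) ++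
      [.eq true (.var (.func f ss)) (.var (.func f ts))]}

/-- The names that are not eliminated: the names `c_f` of the terms that start with a parameter, and
the names `c_p` of the arguments of these terms. -/
def keptNames {C : Type u} (N : Set (Clause (sig L₀ P S) C)) : Set ((sig L₀ P S).Term C) :=
  {t | IsPar t ∧ t ∈ defTerms N} ∪ {s | ∃ t ∈ defTerms N, IsPar t ∧ IsArg s t}

/-- Replace the names `c_f` introduced by definitions `c_f ≈ f(c₁, …, cₖ)`, `f` a parameter, by
their definitions; all other names become variables. -/
def restore {C : Type u} :
    (sig L₀ P S).Term C → (sigP L₀ P).Term ((sig L₀ P S).Term C)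
  | .var c => .var (.var c)
  | .func f ts =>
    Sum.elim
      (Sum.elim (fun g : L₀.Functions _ => .var (.func (Sum.inl (Sum.inl g)) ts))
        fun p : P _ => .func (Sum.inr p) fun i => restore (ts i))
      (fun g : S _ => .var (.func (Sum.inr g) ts)) f

/-- `φ` is a sentence `∀ y, Γ_T(y)` produced from `K`, `G` and `T` by symbol elimination:
`l` lists the clauses of the purified form `G₁` of `K[T] ∪ G`; `Γ₁` is a quantifier-free formula
that is equivalent modulo `T₀` to `∃ x, ⋀ G₁`, where `x` consists of all names except the kept ones;
`Γ₂` is obtained from it by putting back the terms that start with parameters; and `φ` is the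
universal closure of `¬ Γ₂`. -/
def IsConstraint (T₀ : L₀.Theory) {X : Type v} {C : Type u} (K : Set (Clause (sig L₀ P S) X))
    (G : Set (Clause (sig L₀ P S) C)) (T : Set ((sig L₀ P S).Term C))
    (φ : (sigP L₀ P).Sentence) : Prop :=
  ∃ (l : List (Clause L₀ ((sig L₀ P S).Term C))) (Γ₁ : L₀.Formula (keptNames (inst K T ∪ G))),
    (∀ D, D ∈ l ↔ D ∈ purified (inst K T ∪ G) ∪ con (inst K T ∪ G)) ∧
    BoundedFormula.IsQF Γ₁ ∧
    (exOutside (keptNames (inst K T ∪ G)) (conjFormula l) ⇔[T₀] Γ₁) ∧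
    φ = allClosure (BoundedFormula.subst ((inclFun L₀ P).onFormula Γ₁)
      fun t => restore t.1).not

end

end SymbolElimination

/-! Write `N` for `K[T] ∪ G`. In a model `M` of `T₀` with parameters, the constraint fails exactly
when the names can be given values `w` that satisfy the purified and congruence clauses of `N` and
agree, on the kept names, with the restored parameter terms (`IsConstraint.realize_iff`). Both
halves of the claim are statements about such namings.

Soundness: in a total model of `T₀ ∪ K ∪ G`, let every name denote the value of its term. All
clauses of `G₁` then hold, so the constraint fails (`not_satWith_constraint`).

Weakest: suppose the constraint fails in a model `M` of `T₀ ∪ Γ`. A naming `w` yields a finite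
partial structure over `M` (`namedExt`) with `f(w(t₁), …, w(tₙ)) = w(f(t₁, …, tₙ))` for the
extension terms of `N`; the congruence clauses make this well defined. All terms of `N` are then
defined, with the values of their purified forms (`IsNaming.mem_eval`), so every clause of `N` has a
true literal.

The crux is weak satisfaction of `K` (`IsNaming.exists_subst`). If an assignment makes a clause `D`
defined, each extension term of `D` with arguments is evaluated at a point that comes from a term in
`T`. By flatness and linearity these terms can be matched with those of `D` simultaneously by one
substitution, so the assignment comes from an instance in `K[T]`, which has a true literal.
Completability then gives a total model of `T₀ ∪ Γ ∪ K ∪ G`. -/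

namespace SymbolElimination

/-! ### Semantics of clauses and closures; subterms and substitution -/

section Semantics

variable {L : FirstOrder.Language.{u, u}} {X : Type v} {Y : Type w} {M : Type*} [L.Structure M]

theorem realize_lit_eq {b : Bool} {s t : L.Term X} {β : X → M} :
    (Lit.eq b s t).toFormula.Realize β ↔ (b = true ↔ s.realize β = t.realize β) := by
  cases b <;> simp [Lit.toFormula, Formula.realize_not]

theorem realize_lit_rel {b : Bool} {n : ℕ} {R : L.Relations n} {ts : Fin n → L.Term X}
    {β : X → M} :
    (Lit.rel b R ts).toFormula.Realize β ↔
      (b = true ↔ Structure.RelMap R fun i => (ts i).realize β) := by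
  cases b <;> simp [Lit.toFormula, Formula.realize_not]

theorem realize_clauseFormula {D : Clause L X} {β : X → M} :
    (clauseFormula D).Realize β ↔ ∃ l ∈ D, l.toFormula.Realize β := by
  simp only [Formula.Realize, clauseFormula]
  rw [BoundedFormula.realize_foldr_sup]
  simp

theorem realize_conjFormula {l : List (Clause L X)} {β : X → M} :
    (conjFormula l).Realize β ↔ ∀ D ∈ l, (clauseFormula D).Realize β := by
  simp only [Formula.Realize, conjFormula]
  rw [BoundedFormula.realize_foldr_inf]
  simp

theorem realize_lit_subst {σ : X → L.Term Y} {l : Lit L X} {γ : Y → M} :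
    (l.subst σ).toFormula.Realize γ ↔ l.toFormula.Realize fun x => (σ x).realize γ := by
  cases l <;> simp [Lit.subst, realize_lit_eq, realize_lit_rel]

theorem realize_clauseSubst {σ : X → L.Term Y} {D : Clause L X} {γ : Y → M} :
    (clauseFormula (clauseSubst σ D)).Realize γ ↔
      (clauseFormula D).Realize fun x => (σ x).realize γ := by
  simp [realize_clauseFormula, clauseSubst, realize_lit_subst]

theorem realize_allClosure [Nonempty M] {φ : L.Formula X} :
    M ⊨ allClosure φ ↔ ∀ β : X → M, φ.Realize β := by
  classical
  simp only [Sentence.Realize, allClosure, Formula.realize_iAlls]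
  constructor
  · intro h β
    have := h fun x => β x
    rw [Formula.realize_relabel] at this
    exact (BoundedFormula.realize_restrictFreeVar β (by simp)).1 this
  · intro h γ
    rw [Formula.realize_relabel]
    refine (BoundedFormula.realize_restrictFreeVar
      (fun x => if hx : x ∈ φ.freeVarFinset then γ ⟨x, hx⟩ else Classical.arbitrary M) ?_).2 (h _)
    rintro ⟨a, ha⟩
    simp only [Function.comp, Sum.elim_inr, id]
    rw [dif_pos (by convert ha)]

theorem realize_exOutside [Nonempty M] {A : Set X} {φ : L.Formula X} {α : A → M} :
    (exOutside A φ).Realize α ↔ ∃ β : X → M, (∀ a : A, β a = α a) ∧ φ.Realize β := by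
  classical
  simp only [exOutside, Formula.realize_iExs]
  constructor
  · rintro ⟨γ, h⟩
    -- `α` on `A`, the witnesses on the quantified variables, and a default at variables that do not
    -- occur in `φ`.
    let β : X → M := fun x => if hA : x ∈ A then α ⟨x, hA⟩ else
      if hx : x ∈ φ.freeVarFinset then γ ⟨x, by convert hx⟩ else Classical.arbitrary M
    refine ⟨β, fun a => by simp [β], (BoundedFormula.realize_restrictFreeVar β ?_).1 h⟩
    rintro ⟨a, ha⟩
    have ha' : a ∈ φ.freeVarFinset := by convert ha
    by_cases hA : a ∈ A <;> simp [β, hA, ha']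
  · rintro ⟨β, hβ, h⟩
    refine ⟨fun x => β x, (BoundedFormula.realize_restrictFreeVar β ?_).2 h⟩
    rintro ⟨a, ha⟩
    by_cases hA : a ∈ A <;> simp [hA, ← hβ]

theorem model_clauseTheory [Nonempty M] {K : Set (Clause L X)} :
    M ⊨ clauseTheory K ↔ ∀ D ∈ K, ∀ β : X → M, (clauseFormula D).Realize β := by
  simp only [Theory.model_iff, clauseTheory, Set.mem_ofPred_eq]
  constructor
  · intro h D hD
    exact realize_allClosure.1 (h _ ⟨D, hD, rfl⟩)
  · rintro h _ ⟨D, hD, rfl⟩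
    exact realize_allClosure.2 (h D hD)

theorem isQF_relabelEquiv {n : ℕ} (e : X ≃ Y) {φ : L.BoundedFormula X n}
    (h : BoundedFormula.IsQF φ) : BoundedFormula.IsQF (BoundedFormula.relabelEquiv e φ) := by
  induction h with
  | falsum => exact BoundedFormula.IsQF.falsum
  | of_isAtomic h =>
    cases h with
    | equal t₁ t₂ => exact (BoundedFormula.IsAtomic.equal _ _).isQF
    | rel R ts => exact (BoundedFormula.IsAtomic.rel _ _).isQF
  | imp _ _ ih₁ ih₂ => exact ih₁.imp ih₂

/-- Quantifier elimination for formulas with an arbitrary finite type of free variables. -/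
theorem HasQE.exists_isQF {L : FirstOrder.Language.{u, u}} {T : L.Theory} (h : HasQE T)
    {A : Type u} [Finite A] (φ : L.Formula A) :
    ∃ ψ : L.Formula A, BoundedFormula.IsQF ψ ∧ (φ ⇔[T] ψ) := by
  obtain ⟨n, ⟨e⟩⟩ := Finite.exists_equiv_fin A
  obtain ⟨ψ, hψ, hφψ⟩ := h n (BoundedFormula.relabelEquiv e φ)
  refine ⟨BoundedFormula.relabelEquiv e.symm ψ, isQF_relabelEquiv _ hψ, fun M α xs => ?_⟩
  have := hφψ M (α ∘ e.symm) xs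
  rw [BoundedFormula.realize_iff] at this ⊢
  rw [BoundedFormula.realize_relabelEquiv] at this ⊢
  rw [← this, Function.comp_assoc]
  simp

theorem subterms_self (t : L.Term X) : t ∈ subterms t := by
  cases t <;> simp [subterms]

theorem subterms_trans {r s t : L.Term X} (hrs : r ∈ subterms s) (hst : s ∈ subterms t) :
    r ∈ subterms t := by
  induction t with
  | var x => simp only [subterms, Set.mem_singleton_iff] at hst; subst hst; exact hrs
  | func f ts ih =>
    simp only [subterms, Set.mem_union, Set.mem_singleton_iff, Set.mem_iUnion] at hst ⊢
    rcases hst with rfl | ⟨i, hi⟩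
    · simpa [subterms] using hrs
    · exact Or.inr ⟨i, ih i hi⟩

theorem arg_mem_subterms {n : ℕ} (f : L.Functions n) (ts : Fin n → L.Term X) (i : Fin n) :
    ts i ∈ subterms (Term.func f ts) := by
  simp only [subterms, Set.mem_union, Set.mem_iUnion]
  exact Or.inr ⟨i, subterms_self _⟩

theorem finite_subterms (t : L.Term X) : (subterms t).Finite := by
  induction t with
  | var x => simp [subterms]
  | func f ts ih => exact (Set.finite_singleton _).union (Set.finite_iUnion ih)

theorem clauseTerms_of_subterms {D : Clause L X} {s t : L.Term X} (hs : s ∈ subterms t)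
    (ht : t ∈ clauseTerms D) : s ∈ clauseTerms D := by
  obtain ⟨l, hl, ht⟩ := ht
  refine ⟨l, hl, ?_⟩
  cases l with
  | eq b a c => exact ht.imp (subterms_trans hs) (subterms_trans hs)
  | rel b R ts =>
    simp only [Lit.terms, Set.mem_iUnion] at ht ⊢
    exact ht.imp fun i => subterms_trans hs

theorem finite_clauseTerms (D : Clause L X) : (clauseTerms D).Finite := by
  have : clauseTerms D = ⋃ l ∈ {l | l ∈ D}, Lit.terms l := by ext; simp [clauseTerms]
  rw [this]
  refine D.finite_toSet.biUnion fun l _ => ?_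
  cases l with
  | eq b s t => exact (finite_subterms s).union (finite_subterms t)
  | rel b R ts => exact Set.finite_iUnion fun i => finite_subterms _

theorem mem_subterms_subst {σ : X → L.Term Y} {t : L.Term X} {r : L.Term Y}
    (h : r ∈ subterms (t.subst σ)) :
    (∃ s ∈ subterms t, r = s.subst σ) ∨ ∃ x, Term.var x ∈ subterms t ∧ r ∈ subterms (σ x) := by
  induction t with
  | var x => exact Or.inr ⟨x, subterms_self _, h⟩
  | func f ts ih =>
    simp only [Term.subst, subterms, Set.mem_union, Set.mem_singleton_iff, Set.mem_iUnion] at h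
    rcases h with rfl | ⟨i, hi⟩
    · exact Or.inl ⟨_, subterms_self _, rfl⟩
    · rcases ih i hi with ⟨s, hs, rfl⟩ | ⟨x, hx, hr⟩
      · exact Or.inl ⟨s, subterms_trans hs (arg_mem_subterms f ts i), rfl⟩
      · exact Or.inr ⟨x, subterms_trans hx (arg_mem_subterms f ts i), hr⟩

theorem mem_clauseTerms_subst {σ : X → L.Term Y} {D : Clause L X} {r : L.Term Y}
    (h : r ∈ clauseTerms (clauseSubst σ D)) :
    (∃ s ∈ clauseTerms D, r = s.subst σ) ∨
      ∃ x, Term.var x ∈ clauseTerms D ∧ r ∈ subterms (σ x) := by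
  have key : ∀ l ∈ D, ∀ t, subterms t ⊆ Lit.terms l → r ∈ subterms (t.subst σ) →
      (∃ s ∈ clauseTerms D, r = s.subst σ) ∨
        ∃ x, Term.var x ∈ clauseTerms D ∧ r ∈ subterms (σ x) := fun l hl t ht hr =>
    (mem_subterms_subst hr).imp (fun ⟨s, hs, e⟩ => ⟨s, ⟨l, hl, ht hs⟩, e⟩)
      fun ⟨x, hx, e⟩ => ⟨x, ⟨l, hl, ht hx⟩, e⟩
  obtain ⟨l', hl', hr⟩ := h
  obtain ⟨l, hl, rfl⟩ := List.mem_map.1 hl'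
  cases l with
  | eq b s t =>
    rcases hr with hr | hr
    · exact key _ hl s Set.subset_union_left hr
    · exact key _ hl t Set.subset_union_right hr
  | rel b R ts =>
    simp only [Lit.subst, Lit.terms, Set.mem_iUnion] at hr
    obtain ⟨i, hr⟩ := hr
    exact key _ hl (ts i) (Set.subset_iUnion (fun i => subterms (ts i)) i) hr

theorem subst_mem_subterms (σ : X → L.Term Y) {s t : L.Term X} (h : s ∈ subterms t) :
    s.subst σ ∈ subterms (t.subst σ) := by
  induction t with
  | var x => simp only [subterms, Set.mem_singleton_iff] at h; subst h; exact subterms_self _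
  | func f ts ih =>
    simp only [Term.subst, subterms, Set.mem_union, Set.mem_singleton_iff, Set.mem_iUnion] at h ⊢
    rcases h with rfl | ⟨i, hi⟩
    · exact Or.inl rfl
    · exact Or.inr ⟨i, ih i hi⟩

theorem subst_mem_clauseTerms (σ : X → L.Term Y) {D : Clause L X} {t : L.Term X}
    (h : t ∈ clauseTerms D) : t.subst σ ∈ clauseTerms (clauseSubst σ D) := by
  obtain ⟨l, hl, ht⟩ := h
  refine ⟨_, List.mem_map_of_mem hl, ?_⟩
  cases l with
  | eq b a c => exact ht.imp (subst_mem_subterms σ) (subst_mem_subterms σ)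
  | rel b R ts =>
    simp only [Lit.subst, Lit.terms, Set.mem_iUnion] at ht ⊢
    exact ht.imp fun i => subst_mem_subterms σ

theorem exists_relabel_of_closed {t : L.Term X} (h : ∀ x, Term.var x ∉ subterms t) :
    ∃ t₀ : L.Term Empty, t₀.relabel Empty.elim = t := by
  induction t with
  | var x => exact absurd (subterms_self _) (h x)
  | func f ts ih =>
    choose us hus using fun i =>
      ih i fun x hx => h x (subterms_trans hx (arg_mem_subterms f ts i))
    exact ⟨.func f us, by simp [Term.relabel, hus]⟩

theorem relabel_elim_subst (t : L.Term Empty) (σ : X → L.Term Y) :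
    (t.relabel (Empty.elim : Empty → X)).subst σ = t.relabel Empty.elim := by
  induction t with
  | var x => exact x.elim
  | func f ts ih => simp [Term.relabel, Term.subst, ih]

end Semantics

/-! ### Models of the theory extension, its expansions and reducts -/

section Extensions

variable {L₀ : FirstOrder.Language.{u, u}} {P S : ℕ → Type u}

/-- Interpreting the fresh constants amounts to choosing an assignment `C → M`, so from here on
ground clauses are evaluated as clauses with variables in `C`. -/
theorem satWith_iff {C : Type u} {T₀ : L₀.Theory} {Φ : (sigP L₀ P).Theory} {X : Type v}
    {K : Set (Clause (sig L₀ P S) X)} {G : Set (Clause (sig L₀ P S) C)} :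
    SatWith T₀ Φ K G ↔ ∃ (M : Type u) (_ : Nonempty M) (_ : (sig L₀ P S).Structure M)
      (c : C → M), M ⊨ extTheory T₀ Φ K ∧ ∀ D ∈ G, (clauseFormula D).Realize c := by
  constructor
  · rintro ⟨M⟩
    let _ := ((sig L₀ P S).lhomWithConstants C).reduct M
    have h := M.is_model
    rw [Theory.model_union_iff, LHom.onTheory_model, Theory.model_iff {φ | _}] at h
    exact ⟨M, inferInstance, inferInstance, fun c => ((sig L₀ P S).con c : M), h.1,
      fun D hD => (Formula.realize_equivSentence M _).1 (h.2 _ ⟨D, hD, rfl⟩)⟩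
  · rintro ⟨M, _, _, c, hM, hG⟩
    let _ := constantsOn.structure c
    have : M ⊨ ((sig L₀ P S).lhomWithConstants C).onTheory (extTheory T₀ Φ K) ∪
        {φ | ∃ D ∈ G, φ = Formula.equivSentence (clauseFormula D)} := by
      rw [Theory.model_union_iff, LHom.onTheory_model, Theory.model_iff {φ | _}]
      refine ⟨hM, ?_⟩
      rintro _ ⟨D, hD, rfl⟩
      exact (Formula.realize_equivSentence M _).2 (hG D hD)
    exact ⟨Theory.ModelType.of _ M⟩

theorem model_extTheory {T₀ : L₀.Theory} {Φ : (sigP L₀ P).Theory} {X : Type v}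
    {K : Set (Clause (sig L₀ P S) X)} {M : Type*} [Nonempty M] [L₀.Structure M]
    [(sigP L₀ P).Structure M] [(sig L₀ P S).Structure M] [(inclFun L₀ P).IsExpansionOn M]
    [(inclFun (sigP L₀ P) S).IsExpansionOn M] :
    M ⊨ extTheory T₀ Φ K ↔
      M ⊨ T₀ ∧ M ⊨ Φ ∧ ∀ D ∈ K, ∀ β : X → M, (clauseFormula D).Realize β := by
  rw [extTheory, Theory.model_union_iff, LHom.onTheory_model, Theory.model_union_iff,
    LHom.onTheory_model, model_clauseTheory, and_assoc]

end Extensions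

section Interpretation

variable {L₀ : FirstOrder.Language.{u, u}} {P S : ℕ → Type u} {M : Type*}
  [(sigP L₀ P).Structure M]

section

variable [L₀.Structure M] [(inclFun L₀ P).IsExpansionOn M]

theorem funMap_base {n : ℕ} (g : L₀.Functions n) (a : Fin n → M) :
    Structure.funMap (L := sigP L₀ P) (Sum.inl g) a = Structure.funMap g a :=
  LHom.map_onFunction (inclFun L₀ P) g a

theorem relMap_base {n : ℕ} (R : L₀.Relations n) (a : Fin n → M) :
    Structure.RelMap (L := sigP L₀ P) (show (sigP L₀ P).Relations n from R) a ↔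
      Structure.RelMap R a :=
  Iff.of_eq (LHom.map_onRelation (inclFun L₀ P) R a)

end

section

variable [(sig L₀ P S).Structure M] [(inclFun (sigP L₀ P) S).IsExpansionOn M]

theorem funMap_sigP {n : ℕ} (g : (sigP L₀ P).Functions n) (a : Fin n → M) :
    Structure.funMap (L := sig L₀ P S) (Sum.inl g) a = Structure.funMap g a :=
  LHom.map_onFunction (inclFun (sigP L₀ P) S) g a

theorem relMap_sigP {n : ℕ} (R : (sigP L₀ P).Relations n) (a : Fin n → M) :
    Structure.RelMap (L := sig L₀ P S) (show (sig L₀ P S).Relations n from R) a ↔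
      Structure.RelMap R a :=
  Iff.of_eq (LHom.map_onRelation (inclFun (sigP L₀ P) S) R a)

end

end Interpretation

/-! ### Finiteness and soundness of purification -/

section Purification

variable {L₀ : FirstOrder.Language.{u, u}} {P S : ℕ → Type u} {C : Type u}
  {N : Set (Clause (sig L₀ P S) C)}

theorem finite_defTerms (hN : N.Finite) : (defTerms N).Finite := by
  refine (hN.biUnion fun D _ => finite_clauseTerms D).subset ?_
  rintro t ⟨-, D, hD, ht⟩
  exact Set.mem_biUnion hD ht

theorem finite_args {L : FirstOrder.Language.{u, u}} {X : Type v} (t : L.Term X) :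
    {s | IsArg s t}.Finite := by
  refine (finite_subterms t).subset ?_
  rintro s ⟨n, f, ts, i, rfl, rfl⟩
  exact arg_mem_subterms f ts i

theorem finite_keptNames (hN : N.Finite) : (keptNames N).Finite := by
  refine ((finite_defTerms hN).subset fun t h => h.2).union ?_
  refine ((finite_defTerms hN).biUnion fun t _ => finite_args t).subset ?_
  rintro s ⟨t, ht, -, hs⟩
  exact Set.mem_biUnion ht hs

theorem finite_purified (hN : N.Finite) : (purified N).Finite := by
  refine Set.Finite.union ?_ ?_
  · refine (hN.image fun D => D.map purifyLit).subset ?_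
    rintro _ ⟨D, hD, rfl⟩
    exact ⟨D, hD, rfl⟩
  · refine ((finite_defTerms hN).biUnion fun t _ =>
      (finite_args t).image fun s => [Lit.eq true (.var s) (purify s)]).subset ?_
    rintro _ ⟨t, ht, s, hs, rfl⟩
    exact Set.mem_biUnion ht ⟨s, hs, rfl⟩

/-- A congruence clause is determined by its pair of defined terms. -/
theorem finite_con (hN : N.Finite) : (con N).Finite := by
  have h := finite_defTerms hN
  refine (h.biUnion fun s _ => h.biUnion (t := fun t => {D' | ∃ (n : ℕ)
    (f : (sig L₀ P S).Functions n) (ss ts : Fin n → (sig L₀ P S).Term C),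
    s = Term.func f ss ∧ t = Term.func f ts ∧
    D' = (List.ofFn fun i => Lit.eq false (.var (ss i)) (.var (ts i))) ++
      [.eq true (.var (.func f ss)) (.var (.func f ts))]}) fun t _ =>
        Set.Subsingleton.finite ?_).subset ?_
  · rintro _ ⟨n, f, ss, ts, rfl, rfl, rfl⟩ _ ⟨n', f', ss', ts', e, e', rfl⟩
    cases e
    cases e'
    rfl
  · rintro D ⟨n, f, ss, ts, hs, ht, rfl⟩
    exact Set.mem_biUnion hs (Set.mem_biUnion ht ⟨n, f, ss, ts, rfl, rfl, rfl⟩)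

variable {M : Type*}

section

variable [(sigP L₀ P).Structure M] [(sig L₀ P S).Structure M]
  [(inclFun (sigP L₀ P) S).IsExpansionOn M]

/-- Restoring stops at subterms that do not start with a parameter; these become variables, to which
the assignment gives their actual values. -/
theorem realize_restore (c : C → M) (t : (sig L₀ P S).Term C) :
    (restore t).realize (fun s : (sig L₀ P S).Term C => s.realize c) = t.realize c := by
  induction t with
  | var x => rfl
  | func f ts ih =>
    rcases f with (g | p) | g
    · rfl
    · exact (congrArg (Structure.funMap (L := sigP L₀ P) (Sum.inr p)) (funext ih)).trans
        (funMap_sigP (S := S) (Sum.inr p) _).symm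
    · rfl

end

variable [L₀.Structure M]

theorem realize_con {n : ℕ} {f : (sig L₀ P S).Functions n}
    {ss ts : Fin n → (sig L₀ P S).Term C} {w : (sig L₀ P S).Term C → M} :
    (clauseFormula (L := L₀) ((List.ofFn fun i => Lit.eq false (.var (ss i)) (.var (ts i))) ++
      [.eq true (.var (.func f ss)) (.var (.func f ts))])).Realize w ↔
    ((∀ i, w (ss i) = w (ts i)) → w (.func f ss) = w (.func f ts)) := by
  simp only [realize_clauseFormula, List.mem_append, List.mem_ofFn, List.mem_singleton, or_and_right,
    exists_or, exists_eq_left]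
  simp only [↓existsAndEq, realize_lit_eq, Term.realize_var, true_iff,
    Bool.false_eq_true, false_iff]
  simp only [true_and, ← not_forall, imp_iff_not_or]

theorem realize_naming {s : (sig L₀ P S).Term C} {w : (sig L₀ P S).Term C → M} :
    (clauseFormula (L := L₀) [Lit.eq true (.var s) (purify s)]).Realize w ↔
      w s = (purify s).realize w := by
  simp [realize_clauseFormula, realize_lit_eq]

variable [(sigP L₀ P).Structure M] [(sig L₀ P S).Structure M] [(inclFun L₀ P).IsExpansionOn M]
  [(inclFun (sigP L₀ P) S).IsExpansionOn M]

/-- In a total structure, purification is sound if every name denotes the term it names. -/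
theorem realize_purify (c : C → M) (t : (sig L₀ P S).Term C) :
    (purify t).realize (fun s : (sig L₀ P S).Term C => s.realize c) = t.realize c := by
  induction t with
  | var x => rfl
  | func f ts ih =>
    rcases f with (g | p) | g
    · exact (congrArg (Structure.funMap g) (funext ih)).trans
        ((funMap_base g _).symm.trans (funMap_sigP (S := S) (Sum.inl g) _).symm)
    · rfl
    · rfl

theorem realize_purifyLit (c : C → M) (l : Lit (sig L₀ P S) C) :
    (purifyLit l).toFormula.Realize (fun s : (sig L₀ P S).Term C => s.realize c) ↔
      l.toFormula.Realize c := by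
  cases l with
  | eq b s t => simp only [purifyLit, realize_lit_eq, realize_purify]
  | rel b R ts =>
    rw [purifyLit, realize_lit_rel, realize_lit_rel]
    simp only [realize_purify]
    exact iff_congr Iff.rfl ((relMap_base (L₀ := L₀) (P := P) R _).symm.trans (relMap_sigP (L₀ := L₀) (P := P) (S := S) R _).symm)

/-- With names read as the terms they stand for, naming equations become identities, and congruence
clauses hold because symbols denote functions. -/
theorem realize_purified_con {c : C → M} (hN : ∀ D ∈ N, (clauseFormula D).Realize c)
    {D : Clause L₀ ((sig L₀ P S).Term C)} (hD : D ∈ purified N ∪ con N) :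
    (clauseFormula D).Realize fun s : (sig L₀ P S).Term C => s.realize c := by
  rcases hD with (⟨D, hD, rfl⟩ | ⟨t, ht, s, hs, rfl⟩) | ⟨n, f, ss, ts, hs, ht, rfl⟩
  · obtain ⟨l, hl, h⟩ := realize_clauseFormula.1 (hN D hD)
    exact realize_clauseFormula.2 ⟨_, List.mem_map_of_mem hl, (realize_purifyLit c l).2 h⟩
  · exact realize_naming.2 (realize_purify c s).symm
  · refine realize_con.2 fun h => ?_
    simp only [Term.realize, h]

end Purification

/-! ### Existence, meaning and soundness of the constraint -/

section Constraint

variable {L₀ : FirstOrder.Language.{u, u}} {P S : ℕ → Type u} {C : Type u} {X : Type v}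
  {T₀ : L₀.Theory} {K : Set (Clause (sig L₀ P S) X)} {G : Set (Clause (sig L₀ P S) C)}
  {T : Set ((sig L₀ P S).Term C)} {φ : (sigP L₀ P).Sentence}

/-- Finiteness of `K[T] ∪ G` makes `G₁` a single conjunction and leaves finitely many kept names, so
that quantifier elimination applies. -/
theorem exists_isConstraint (hQE : HasQE T₀) (hN : (inst K T ∪ G).Finite) :
    ∃ φ, IsConstraint T₀ K G T φ := by
  have h := (finite_purified hN).union (finite_con hN)
  have := (finite_keptNames hN).to_subtype
  obtain ⟨Γ₁, hQF, hΓ₁⟩ := hQE.exists_isQF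
    (exOutside (keptNames (inst K T ∪ G)) (conjFormula h.toFinset.toList))
  exact ⟨_, _, Γ₁, fun D => by simp, hQF, hΓ₁, rfl⟩

/-- Semantics of the constraint: it excludes that the purified clauses can be satisfied by names
whose values agree, on the kept names, with those of the terms put back for them. -/
theorem IsConstraint.realize_iff (h : IsConstraint T₀ K G T φ) {M : Type u} [Nonempty M]
    [L₀.Structure M] [(sigP L₀ P).Structure M] [(inclFun L₀ P).IsExpansionOn M] (hM : M ⊨ T₀) :
    M ⊨ φ ↔ ∀ y w : (sig L₀ P S).Term C → M,
      (∀ t ∈ keptNames (inst K T ∪ G), w t = (restore t).realize y) →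
      ¬ ∀ D ∈ purified (inst K T ∪ G) ∪ con (inst K T ∪ G), (clauseFormula D).Realize w := by
  obtain ⟨l, Γ₁, hl, -, hΓ₁, rfl⟩ := h
  rw [realize_allClosure]
  refine forall_congr' fun y => ?_
  -- For fixed `y`, the substitution evaluates `Γ₁` at the values of the restored terms; modulo `T₀`
  -- this says that these values extend to a solution `w` of `G₁`.
  have h₁ := hΓ₁.realize_iff (M := M)
    (v := fun t : keptNames (inst K T ∪ G) => (restore t.1).realize y)
  have h₂ := realize_exOutside (φ := conjFormula l)
    (α := fun t : keptNames (inst K T ∪ G) => (restore t.1).realize y)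
  rw [Formula.realize_not, Formula.Realize, BoundedFormula.realize_subst, ← Formula.Realize,
    LHom.realize_onFormula]
  rw [h₂] at h₁
  rw [← h₁]
  simp only [not_exists, not_and, realize_conjFormula, hl, Subtype.forall]

theorem not_satWith_constraint (h : IsConstraint T₀ K G T φ) : ¬ SatWith T₀ {φ} K G := by
  rw [satWith_iff]
  rintro ⟨M, _, _, c, hM, hG⟩
  let _ := (inclFun (sigP L₀ P) S).reduct M
  let _ := (inclFun L₀ P).reduct M
  obtain ⟨hT₀, hφ, hK⟩ := model_extTheory.1 hM
  have hφ : M ⊨ φ := Theory.realize_sentence_of_mem (T := {φ}) rfl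
  -- The actual values of the terms serve both as `y` and as `w`.
  refine (h.realize_iff hT₀).1 hφ (fun s => s.realize c) (fun s => s.realize c)
    (fun t _ => (realize_restore c t).symm) fun D hD => realize_purified_con ?_ hD
  rintro _ (⟨D, hD, σ, rfl, -⟩ | hD)
  · exact realize_clauseSubst.2 (hK D hD _)
  · exact hG _ hD

end Constraint

/-! ### Evaluation in partial structures and transfer to total extensions -/

section PartialStructures

variable {L₀ : FirstOrder.Language.{u, u}} {P S : ℕ → Type u} {M : Type u}
  [(sigP L₀ P).Structure M] {X : Type v} {Y : Type w}

namespace PartialExt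

variable (A : PartialExt S M)

/-- The relational form of evaluation, which keeps proofs of definedness out of the later arguments.
-/
theorem mem_eval_func {β : X → M} {n : ℕ} {f : (sig L₀ P S).Functions n}
    {ts : Fin n → (sig L₀ P S).Term X} {b : M} :
    b ∈ A.eval β (.func f ts) ↔ ∃ a : Fin n → M, (∀ i, a i ∈ A.eval β (ts i)) ∧
      b ∈ Sum.elim (fun g : (sigP L₀ P).Functions _ => Part.some (Structure.funMap g a))
        (fun g : S _ => A.fn g a) f := by
  simp only [eval, Part.mem_bind_iff, Part.mem_mk_iff]
  constructor
  · rintro ⟨a, ⟨h, rfl⟩, hb⟩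
    exact ⟨_, fun i => Part.get_mem (h i), hb⟩
  · rintro ⟨a, h, hb⟩
    exact ⟨a, ⟨fun i => (h i).1, funext fun i => (h i).2⟩, hb⟩

variable {A}

theorem dom_of_mem_subterms {β : X → M} {s t : (sig L₀ P S).Term X} (hs : s ∈ subterms t)
    (ht : (A.eval β t).Dom) : (A.eval β s).Dom := by
  induction t with
  | var x => simp only [subterms, Set.mem_singleton_iff] at hs; subst hs; exact ht
  | func f ts ih =>
    simp only [subterms, Set.mem_union, Set.mem_singleton_iff, Set.mem_iUnion] at hs
    rcases hs with rfl | ⟨i, hi⟩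
    · exact ht
    · obtain ⟨b, hb⟩ := Part.dom_iff_mem.1 ht
      obtain ⟨a, ha, -⟩ := (A.mem_eval_func).1 hb
      exact ih i hi (ha i).1

theorem dom_of_mem_clauseTerms {β : X → M} {D : Clause (sig L₀ P S) X}
    (hD : ∀ l ∈ D, A.LitDefined β l) {t : (sig L₀ P S).Term X} (ht : t ∈ clauseTerms D) :
    (A.eval β t).Dom := by
  obtain ⟨l, hl, ht⟩ := ht
  have h := hD l hl
  cases l with
  | eq b s s' =>
    rcases ht with ht | ht
    · exact dom_of_mem_subterms ht h.1
    · exact dom_of_mem_subterms ht h.2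
  | rel b R ts =>
    obtain ⟨i, hi⟩ := Set.mem_iUnion.1 ht
    exact dom_of_mem_subterms hi (h i)

/-- Only the variables that occur are constrained: `σ` will be matched with `β` on the variables of
one clause alone. -/
theorem eval_subst {β : X → M} {γ : Y → M} {σ : X → (sig L₀ P S).Term Y}
    {t : (sig L₀ P S).Term X}
    (h : ∀ x, Term.var x ∈ subterms t → β x ∈ A.eval γ (σ x)) :
    A.eval γ (t.subst σ) = A.eval β t := by
  induction t with
  | var x => exact (Part.eq_some_iff.2 (h x (subterms_self _)))
  | func f ts ih =>
    have ih' := fun i => ih i fun x hx => h x (subterms_trans hx (arg_mem_subterms f ts i))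
    ext b
    rw [Term.subst, mem_eval_func, mem_eval_func]
    simp only [ih']

theorem eval_relabel_elim {γ : X → M} (t : (sig L₀ P S).Term Empty) :
    A.eval γ (t.relabel Empty.elim) = A.eval Empty.elim t := by
  induction t with
  | var x => exact x.elim
  | func f ts ih =>
    ext b
    refine (mem_eval_func _).trans (Iff.trans ?_ (mem_eval_func _).symm)
    simp only [ih]

theorem litTrue_subst {β : X → M} {γ : Y → M} {σ : X → (sig L₀ P S).Term Y}
    {l : Lit (sig L₀ P S) X}
    (h : ∀ x, Term.var x ∈ Lit.terms l → β x ∈ A.eval γ (σ x)) :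
    A.LitTrue γ (l.subst σ) ↔ A.LitTrue β l := by
  cases l with
  | eq b s t =>
    simp only [LitTrue, Lit.subst]
    rw [eval_subst fun x hx => h x (Or.inl hx), eval_subst fun x hx => h x (Or.inr hx)]
  | rel b R ts =>
    have h' := fun i => eval_subst (A := A) (t := ts i) fun x hx => h x (Set.mem_iUnion.2 ⟨i, hx⟩)
    simp only [LitTrue, Lit.subst, h']

/-- A total structure that extends the partial functions. -/
def Extends [(sig L₀ P S).Structure M] (A : PartialExt S M) : Prop :=
  ∀ (n : ℕ) (f : S n) (a : Fin n → M), ∀ b ∈ A.fn f a,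
    Structure.funMap (L := sig L₀ P S) (Sum.inr f) a = b

variable [(sig L₀ P S).Structure M] [(inclFun (sigP L₀ P) S).IsExpansionOn M]

/-- Evaluation is strict, so a defined value is computed from defined values only, and these the
total structure preserves. -/
theorem Extends.realize_eq (hA : Extends (L₀ := L₀) (P := P) A) {β : X → M}
    {t : (sig L₀ P S).Term X} {b : M} (h : b ∈ A.eval β t) : t.realize β = b := by
  induction t generalizing b with
  | var x => exact (Part.mem_some_iff.1 h).symm
  | func f ts ih =>
    obtain ⟨a, ha, hb⟩ := A.mem_eval_func.1 h
    refine (congrArg (Structure.funMap f) (funext fun i => ih i (ha i))).trans ?_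
    rcases f with g | g
    · exact (funMap_sigP g a).trans (Part.mem_some_iff.1 hb).symm
    · exact hA _ g a b hb

theorem Extends.realize_of_litTrue (hA : Extends (L₀ := L₀) (P := P) A) {β : X → M}
    {l : Lit (sig L₀ P S) X} (h : A.LitTrue β l) : l.toFormula.Realize β := by
  cases l with
  | eq b s t =>
    obtain ⟨x, hx, y, hy, e⟩ := h
    rw [realize_lit_eq, hA.realize_eq hx, hA.realize_eq hy]
    exact e
  | rel b R ts =>
    obtain ⟨a, ha, e⟩ := h
    rw [realize_lit_rel]
    simp only [fun i => hA.realize_eq (ha i)]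
    exact e.trans (relMap_sigP (L₀ := L₀) (P := P) (S := S) R a).symm

end PartialExt

end PartialStructures

/-! ### The partial structure read off from a naming -/

section NamedStructure

variable {L₀ : FirstOrder.Language.{u, u}} {P S : ℕ → Type u} {C : Type u} {M : Type u}

open Classical in
/-- The partial structure in which an extension function is defined precisely where the definitions
of the names prescribe it (and at constants), for values `w` of the names. -/
noncomputable def namedExt [Nonempty M] (N : Set (Clause (sig L₀ P S) C))
    (w : (sig L₀ P S).Term C → M) : PartialExt S M where
  fn {n} f a :=
    { Dom := n = 0 ∨ ∃ ts : Fin n → (sig L₀ P S).Term C,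
        Term.func (Sum.inr f) ts ∈ defTerms N ∧ w ∘ ts = a
      -- Any matching definition may be chosen, by the congruence clauses. The default is reached
      -- only by constants that have no definition in `N`.
      get := fun _ => if h : ∃ ts : Fin n → (sig L₀ P S).Term C,
        Term.func (Sum.inr f) ts ∈ defTerms N ∧ w ∘ ts = a then
          w (.func (Sum.inr f) h.choose) else Classical.arbitrary M }
  const_dom _ _ := Or.inl rfl

/-- Each defined term contributes at most one point, and so does each extension constant, of which
there are finitely many. -/
theorem finite_dom_namedExt [Nonempty M] [Finite (S 0)] {N : Set (Clause (sig L₀ P S) C)}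
    (hN : N.Finite) (w : (sig L₀ P S).Term C → M) :
    {q : Σ n : ℕ, S n × (Fin n → M) | ((namedExt N w).fn q.2.1 q.2.2).Dom}.Finite := by
  refine ((Set.finite_range fun c : S 0 => (⟨0, c, Fin.elim0⟩ : Σ n : ℕ, S n × (Fin n → M))).union
    ((finite_defTerms hN).biUnion (t := fun t => {q | ∃ ts : Fin q.1 → (sig L₀ P S).Term C,
      t = .func (Sum.inr q.2.1) ts ∧ w ∘ ts = q.2.2}) fun t _ =>
        Set.Subsingleton.finite ?_)).subset ?_
  · rintro ⟨n, f, a⟩ ⟨ts, rfl, ha⟩ ⟨n', f', a'⟩ ⟨ts', e, ha'⟩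
    dsimp only at ts ha ts' e ha'
    subst ha ha'
    cases e
    rfl
  · rintro ⟨n, f, a⟩ (h | ⟨ts, ht, ha⟩)
    · dsimp only at h
      subst h
      exact Or.inl ⟨f, by rw [Subsingleton.elim a Fin.elim0]⟩
    · exact Or.inr (Set.mem_biUnion ht ⟨ts, rfl, ha⟩)

section

variable [L₀.Structure M] {N : Set (Clause (sig L₀ P S) C)} {w : (sig L₀ P S).Term C → M}
variable (hw : ∀ D ∈ purified N ∪ con N, (clauseFormula D).Realize w)
include hw

theorem name_arg {n : ℕ} {f : (sig L₀ P S).Functions n} {ts : Fin n → (sig L₀ P S).Term C}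
    (h : Term.func f ts ∈ defTerms N) (i : Fin n) : w (ts i) = (purify (ts i)).realize w :=
  realize_naming.1 (hw _ (Or.inl (Or.inr ⟨_, h, _, ⟨n, f, ts, i, rfl, rfl⟩, rfl⟩)))

/-- The definition chosen in `namedExt` has arguments with the same values as `ts`, so a congruence
clause equates the two names. -/
theorem mem_fn_namedExt [Nonempty M] {n : ℕ} {f : S n} {ts : Fin n → (sig L₀ P S).Term C}
    (h : Term.func (Sum.inr f) ts ∈ defTerms N) :
    w (.func (Sum.inr f) ts) ∈ (namedExt N w).fn f (w ∘ ts) := by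
  have hex : ∃ us : Fin n → (sig L₀ P S).Term C,
    Term.func (Sum.inr f) us ∈ defTerms N ∧ w ∘ us = w ∘ ts := ⟨ts, h, rfl⟩
  refine ⟨Or.inr hex, ?_⟩
  refine (dif_pos hex).trans ?_
  exact realize_con.1 (hw _ (Or.inr ⟨n, _, _, _, hex.choose_spec.1, h, rfl⟩))
    fun i => congrFun hex.choose_spec.2 i

end

variable [L₀.Structure M] [(sigP L₀ P).Structure M] [(inclFun L₀ P).IsExpansionOn M]
  {N : Set (Clause (sig L₀ P S) C)} {w y : (sig L₀ P S).Term C → M}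

variable [Nonempty M]

/-- Values of the names that satisfy the purified clauses and are compatible with the parameters. -/
structure IsNaming (N : Set (Clause (sig L₀ P S) C)) (w y : (sig L₀ P S).Term C → M) : Prop where
  clauses : ∀ D ∈ purified N ∪ con N, (clauseFormula D).Realize w
  kept : ∀ t ∈ keptNames N, w t = (restore t).realize y

namespace IsNaming

variable (hw : IsNaming N w y)
include hw

/-- The link between `w` and the partial structure: purified truth under `w` becomes truth of the
original clauses. -/
theorem mem_eval {D : Clause (sig L₀ P S) C} (hD : D ∈ N) {t : (sig L₀ P S).Term C}
    (ht : t ∈ clauseTerms D) :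
    (purify t).realize w ∈ (namedExt N w).eval (fun c => w (.var c)) t := by
  induction t with
  | var c => exact Part.mem_some _
  | func f ts ih =>
    have ih' := fun i => ih i (clauseTerms_of_subterms (arg_mem_subterms f ts i) ht)
    refine (PartialExt.mem_eval_func _).2 ⟨_, ih', ?_⟩
    rcases f with (g | p) | g
    · exact Part.mem_some_iff.2 (funMap_base g _).symm
    · have hdef : Term.func (Sum.inl (Sum.inr p)) ts ∈ defTerms N :=
        ⟨Or.inl ⟨_, p, ts, rfl⟩, D, hD, ht⟩
      have hpar : IsPar (S := S) (Term.func (Sum.inl (Sum.inr p)) ts) := ⟨_, p, ts, rfl⟩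
      -- A parameter term and its arguments all have kept names. Hence `w` respects the
      -- interpretation of `p` in `M`, and the naming equations replace the names of the arguments
      -- by their purified forms.
      refine Part.mem_some_iff.2 ((hw.kept _ (Or.inl ⟨hpar, hdef⟩)).trans ?_)
      refine congrArg (Structure.funMap (L := sigP L₀ P) (Sum.inr p)) (funext fun i => ?_)
      exact (hw.kept _ (Or.inr ⟨_, hdef, hpar, _, _, ts, i, rfl, rfl⟩)).symm.trans
        (name_arg hw.clauses hdef i)
    · have hdef : Term.func (Sum.inr g) ts ∈ defTerms N := ⟨Or.inr ⟨_, g, ts, rfl⟩, D, hD, ht⟩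
      have := mem_fn_namedExt hw.clauses hdef
      rwa [show w ∘ ts = fun i => (purify (ts i)).realize w from
        funext fun i => name_arg hw.clauses hdef i] at this

theorem mem_eval_arg {n : ℕ} {f : (sig L₀ P S).Functions n}
    {ts : Fin n → (sig L₀ P S).Term C} (h : Term.func f ts ∈ defTerms N) (i : Fin n) :
    w (ts i) ∈ (namedExt N w).eval (fun c => w (.var c)) (ts i) := by
  rw [name_arg hw.clauses h i]
  obtain ⟨-, D, hD, ht⟩ := h
  exact hw.mem_eval hD (clauseTerms_of_subterms (arg_mem_subterms f ts i) ht)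

theorem litTrue_of_purifyLit {D : Clause (sig L₀ P S) C} (hD : D ∈ N) {l : Lit (sig L₀ P S) C}
    (hl : l ∈ D) (h : (purifyLit l).toFormula.Realize w) :
    (namedExt N w).LitTrue (fun c => w (.var c)) l := by
  cases l with
  | eq b s t =>
    exact ⟨_, hw.mem_eval hD ⟨_, hl, Or.inl (subterms_self s)⟩,
      _, hw.mem_eval hD ⟨_, hl, Or.inr (subterms_self t)⟩, realize_lit_eq.1 h⟩
  | rel b R ts =>
    refine ⟨_, fun i => hw.mem_eval hD ⟨_, hl, Set.mem_iUnion.2 ⟨i, subterms_self (ts i)⟩⟩, ?_⟩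
    exact (realize_lit_rel.1 h).trans (relMap_base (L₀ := L₀) (P := P) R _).symm

theorem exists_litTrue {D : Clause (sig L₀ P S) C} (hD : D ∈ N) :
    ∃ l ∈ D, (namedExt N w).LitTrue (fun c => w (.var c)) l := by
  obtain ⟨l', hl', h⟩ := realize_clauseFormula.1 (hw.clauses _ (Or.inl (Or.inl ⟨D, hD, rfl⟩)))
  obtain ⟨l, hl, rfl⟩ := List.mem_map.1 hl'
  exact ⟨l, hl, hw.litTrue_of_purifyLit hD hl h⟩

/-- A clause is weakly satisfied if all assignments that make it defined come from an instance. -/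
theorem weaklySatisfies {X : Type v} {D : Clause (sig L₀ P S) X}
    (h : ∀ β : X → M, (∀ l ∈ D, (namedExt N w).LitDefined β l) →
      ∃ σ : X → (sig L₀ P S).Term C, clauseSubst σ D ∈ N ∧ ∀ x, Term.var x ∈ clauseTerms D →
        β x ∈ (namedExt N w).eval (fun c => w (.var c)) (σ x)) :
    (namedExt N w).WeaklySatisfies D := by
  intro β
  by_cases hdef : ∀ l ∈ D, (namedExt N w).LitDefined β l
  · obtain ⟨σ, hσ, hβ⟩ := h β hdef
    obtain ⟨l', hl', hl'true⟩ := hw.exists_litTrue hσ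
    obtain ⟨l, hl, rfl⟩ := List.mem_map.1 hl'
    exact Or.inr ⟨hdef, l, hl,
      (PartialExt.litTrue_subst fun x hx => hβ x ⟨l, hl, hx⟩).1 hl'true⟩
  · push Not at hdef
    exact Or.inl hdef

end IsNaming

end NamedStructure

/-! ### Lifting assignments to instances in `K[T]` -/

section Instances

variable {L₀ : FirstOrder.Language.{u, u}} {P S : ℕ → Type u} {C : Type u} {X : Type v}
  {K : Set (Clause (sig L₀ P S) X)} {G : Set (Clause (sig L₀ P S) C)}

/-- Passing from `G` to `K[T] ∪ G` creates no extension terms outside `T`. -/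
theorem mem_est_of_mem_clauseTerms {D : Clause (sig L₀ P S) C}
    (hD : D ∈ inst K (est K G) ∪ G) {t : (sig L₀ P S).Term C} (ht : t ∈ clauseTerms D)
    (hext : IsExt t) : t ∈ est K G := by
  rcases hD with ⟨D, -, σ, rfl, h⟩ | hD
  · exact h t ht hext
  · exact Or.inl ⟨hext, D, hD, ht⟩

/-- A variable-free term of `K` that starts with an extension function is in `est K G`. -/
theorem subst_mem_est_of_closed {D : Clause (sig L₀ P S) X} (hD : D ∈ K)
    {t : (sig L₀ P S).Term X} (ht : t ∈ clauseTerms D) (hext : IsExt t)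
    (hclosed : ∀ x, Term.var x ∉ subterms t) (σ : X → (sig L₀ P S).Term C) :
    t.subst σ ∈ est K G := by
  obtain ⟨t₀, rfl⟩ := exists_relabel_of_closed hclosed
  refine Or.inr ⟨t₀, ⟨?_, D, hD, ht⟩, relabel_elim_subst t₀ σ⟩
  obtain ⟨n, f, ts, e⟩ := hext
  cases t₀ with
  | var x => exact x.elim
  | func g us =>
    rw [Term.relabel] at e
    cases e
    exact ⟨_, f, us, rfl⟩

theorem isExt_of_isExt_subst {σ : X → (sig L₀ P S).Term C} {t : (sig L₀ P S).Term X}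
    (h : IsExt (t.subst σ)) : IsExt t ∨ ∃ x, t = .var x := by
  cases t with
  | var x => exact Or.inr ⟨x, rfl⟩
  | func g us =>
    obtain ⟨n, f, ts, e⟩ := h
    rw [Term.subst] at e
    cases e
    exact Or.inl ⟨_, f, us, rfl⟩

/-- A substitution yields an instance in `K[T]` if it maps the terms of the clause that start with
an extension function, and all such subterms of the terms substituted, into `T`. -/
theorem clauseSubst_mem_inst {T : Set ((sig L₀ P S).Term C)} {D : Clause (sig L₀ P S) X}
    (hD : D ∈ K) {σ : X → (sig L₀ P S).Term C}
    (h : ∀ t ∈ clauseTerms D, IsExt t → t.subst σ ∈ T)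
    (hσ : ∀ x, Term.var x ∈ clauseTerms D → ∀ s ∈ subterms (σ x), IsExt s → s ∈ T) :
    clauseSubst σ D ∈ inst K T := by
  refine ⟨D, hD, σ, rfl, fun t ht hext => ?_⟩
  rcases mem_clauseTerms_subst ht with ⟨s, hs, rfl⟩ | ⟨x, hx, hr⟩
  · rcases isExt_of_isExt_subst hext with hs' | ⟨x, rfl⟩
    · exact h s hs hs'
    · exact hσ x hs _ (subterms_self _) hext
  · exact hσ x hx t hr hext

theorem clauseSubst_mem_inst_of_isGround {D : Clause (sig L₀ P S) X} (hD : D ∈ K)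
    (hg : IsGround D) (σ : X → (sig L₀ P S).Term C) : clauseSubst σ D ∈ inst K (est K G) :=
  clauseSubst_mem_inst hD (fun _ ht hext => subst_mem_est_of_closed hD ht hext
    (fun x hx => hg x (clauseTerms_of_subterms hx ht)) σ) fun x hx => absurd hx (hg x)

/-- In a non-ground flat linear clause, the arguments of the terms that start with an extension
function can be chosen independently of each other. -/
theorem exists_subst_of_linear [Nonempty C] {D : Clause (sig L₀ P S) X} (hg : ¬ IsGround D)
    (hlin : IsLinear D)
    (U : ∀ {n : ℕ}, S n → (Fin n → X) → (Fin n → (sig L₀ P S).Term C)) :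
    ∃ σ : X → (sig L₀ P S).Term C, ∀ (n : ℕ) (f : S n) (xs : Fin n → X),
      Term.func (Sum.inr f) (fun i => Term.var (xs i)) ∈ clauseTerms D →
        ∀ i, σ (xs i) = U f xs i := by
  classical
  have hlin := hlin.2 hg
  -- `Q x u`: some argument position of an extension term of `D` holds `x` and demands the value
  -- `u`. Linearity makes this position unique.
  let Q (x : X) (u : (sig L₀ P S).Term C) : Prop := ∃ (n : ℕ) (f : S n) (xs : Fin n → X)
    (i : Fin n), Term.func (Sum.inr f) (fun i => Term.var (xs i)) ∈ clauseTerms D ∧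
      xs i = x ∧ U f xs i = u
  have hmem : ∀ {n : ℕ} (f : S n) (xs : Fin n → X) (i : Fin n), Term.var (xs i) ∈
      subterms (Term.func (L := sig L₀ P S) (Sum.inr f) (fun i => Term.var (xs i))) :=
    fun f xs i => arg_mem_subterms _ (fun i => Term.var (xs i)) i
  have hQ : ∀ x u u', Q x u → Q x u' → u = u' := by
    rintro _ _ _ ⟨n, f, xs, i, ht, rfl, rfl⟩ ⟨n', f', xs', i', ht', hx, rfl⟩
    have e := hlin.1 _ ⟨xs i, rfl⟩ _ ht _ ht' ⟨_, f, _, rfl⟩ ⟨_, f', _, rfl⟩ (hmem f xs i)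
      (hx ▸ hmem f' xs' i')
    obtain ⟨rfl, e₁, e₂⟩ := Term.func.inj e
    obtain rfl := Sum.inr_injective (eq_of_heq e₁)
    have : xs = xs' := funext fun j => Term.var.inj (congrFun (eq_of_heq e₂) j)
    subst this
    have : i = i' := by
      by_contra hne
      have hocc := hlin.2 _ ⟨xs i, rfl⟩ _ ht ⟨_, f, _, rfl⟩
      simp only [occurrences] at hocc
      -- Two distinct positions `i`, `i'` with the same variable would already contribute 2 to the
      -- number of occurrences.
      have := Finset.sum_le_sum_of_subset (f := fun j => if Term.var (L := sig L₀ P S) (xs i) =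
        .var (xs j) then 1 else 0) (Finset.subset_univ {i, i'})
      rw [Finset.sum_pair hne] at this
      simp [hx] at this hocc
      omega
    rw [this]
  refine ⟨fun x => if h : ∃ u, Q x u then h.choose else .var (Classical.arbitrary C),
    fun n f xs ht i => ?_⟩
  have hex : ∃ u, Q (xs i) u := ⟨_, n, f, xs, i, ht, rfl, rfl⟩
  exact (dif_pos hex).trans (hQ _ _ _ hex.choose_spec ⟨n, f, xs, i, ht, rfl, rfl⟩)

theorem exists_vars_of_isFlat {D : Clause (sig L₀ P S) X} (hg : ¬ IsGround D) (hflat : IsFlat D)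
    {t : (sig L₀ P S).Term X} (ht : t ∈ clauseTerms D) (hext : IsExt t) :
    ∃ (n : ℕ) (f : S n) (xs : Fin n → X), t = .func (Sum.inr f) fun i => .var (xs i) := by
  obtain ⟨n, f, ts, rfl⟩ := hext
  choose xs hxs using fun i => hflat.2 hg _ ht ⟨n, f, ts, rfl⟩ _ ⟨n, _, ts, i, rfl, rfl⟩
  exact ⟨n, f, xs, congrArg _ (funext hxs)⟩

variable {M : Type u} [Nonempty M] [L₀.Structure M] [(sigP L₀ P).Structure M]
  [(inclFun L₀ P).IsExpansionOn M] {w y : (sig L₀ P S).Term C → M}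

/-- A non-constant term `f(xs)` of `D` is defined under `β` only because some `f(us)` in `T`
satisfies `w ∘ us = β ∘ xs`; put `σ (xs i) = us i`. Every variable of `D` lies below an extension
function, so `σ` matches `β` on all of them. -/
theorem IsNaming.exists_subst [Nonempty C] (hw : IsNaming (inst K (est K G) ∪ G) w y)
    {D : Clause (sig L₀ P S) X} (hD : D ∈ K) (hvars : VarsBelowExt D) (hflat : IsFlat D)
    (hlin : IsLinear D) {β : X → M}
    (hβ : ∀ l ∈ D, (namedExt (inst K (est K G) ∪ G) w).LitDefined β l) :
    ∃ σ : X → (sig L₀ P S).Term C, clauseSubst σ D ∈ inst K (est K G) ∪ G ∧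
      ∀ x, Term.var x ∈ clauseTerms D →
        β x ∈ (namedExt (inst K (est K G) ∪ G) w).eval (fun c => w (.var c)) (σ x) := by
  classical
  set N := inst K (est K G) ∪ G
  by_cases hg : IsGround D
  · exact ⟨fun _ => .var (Classical.arbitrary C),
      Or.inl (clauseSubst_mem_inst_of_isGround hD hg _), fun x hx => absurd hx (hg x)⟩
  -- Constants are excluded, since they are defined even without a definition in `N`.
  have hdef : ∀ {n : ℕ} (f : S n) (xs : Fin n → X),
      Term.func (Sum.inr f) (fun i => Term.var (xs i)) ∈ clauseTerms D → n ≠ 0 →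
      ∃ us : Fin n → (sig L₀ P S).Term C,
        Term.func (Sum.inr f) us ∈ defTerms N ∧ ∀ i, w (us i) = β (xs i) := by
    intro n f xs ht hn
    obtain ⟨b, hb⟩ := Part.dom_iff_mem.1 (PartialExt.dom_of_mem_clauseTerms hβ ht)
    obtain ⟨a, ha, hb⟩ := (PartialExt.mem_eval_func _).1 hb
    rcases hb.1 with h | ⟨us, hus, e⟩
    · exact absurd h hn
    · exact ⟨us, hus, fun i => (congrFun e i).trans (Part.mem_some_iff.1 (ha i))⟩
  obtain ⟨σ, hσ⟩ := exists_subst_of_linear (C := C) hg hlin fun {n} f xs =>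
    if h : ∃ us : Fin n → (sig L₀ P S).Term C,
      Term.func (Sum.inr f) us ∈ defTerms N ∧ ∀ i, w (us i) = β (xs i) then h.choose
    else fun _ => .var (Classical.arbitrary C)
  have hσ' : ∀ {n : ℕ} (f : S n) (xs : Fin n → X),
      Term.func (Sum.inr f) (fun i => Term.var (xs i)) ∈ clauseTerms D → n ≠ 0 →
      Term.func (Sum.inr f) (fun i => σ (xs i)) ∈ defTerms N ∧
        ∀ i, w (σ (xs i)) = β (xs i) := by
    intro n f xs ht hn
    have hex := hdef f xs ht hn
    have e : (fun i => σ (xs i)) = hex.choose :=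
      funext fun i => (hσ n f xs ht i).trans (congrFun (dif_pos hex) i)
    exact ⟨e ▸ hex.choose_spec.1, fun i => (congrArg w (congrFun e i)).trans
      (hex.choose_spec.2 i)⟩
  have hbelow : ∀ x, Term.var x ∈ clauseTerms D → ∃ (n : ℕ) (f : S n) (xs : Fin n → X)
      (i : Fin n), Term.func (Sum.inr f) (fun i => Term.var (xs i)) ∈ clauseTerms D ∧
        xs i = x := by
    intro x hx
    obtain ⟨t, ht, hext, hxt⟩ := hvars x hx
    obtain ⟨n, f, xs, rfl⟩ := exists_vars_of_isFlat hg hflat ht hext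
    simp only [subterms, Set.mem_union, Set.mem_singleton_iff, Set.mem_iUnion] at hxt
    rcases hxt with h | ⟨i, h⟩
    · cases h
    · exact ⟨n, f, xs, i, ht, (Term.var.inj h).symm⟩
  refine ⟨σ, Or.inl (clauseSubst_mem_inst hD (fun t ht hext => ?_) fun x hx s hs hext => ?_),
    fun x hx => ?_⟩
  · obtain ⟨n, f, xs, rfl⟩ := exists_vars_of_isFlat hg hflat ht hext
    -- An extension constant of `D` belongs to `est K G` as a ground term of `K`; other extension
    -- terms become defined terms of `N`.
    rcases Nat.eq_zero_or_pos n with rfl | hn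
    · refine subst_mem_est_of_closed hD ht hext (fun x hx => ?_) σ
      simp [subterms] at hx
    · obtain ⟨-, D', hD', ht'⟩ := (hσ' f xs ht hn.ne').1
      exact mem_est_of_mem_clauseTerms hD' ht' ⟨n, f, _, rfl⟩
  -- `σ x` is an argument of a defined term of `N`, so extension terms inside it also occur in `N`.
  · obtain ⟨n, f, xs, i, ht, rfl⟩ := hbelow x hx
    obtain ⟨-, D', hD', ht'⟩ := (hσ' f xs ht (Fin.pos i).ne').1
    exact mem_est_of_mem_clauseTerms hD' (clauseTerms_of_subterms
      (subterms_trans hs (arg_mem_subterms _ (fun i => σ (xs i)) i)) ht') hext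
  · obtain ⟨n, f, xs, i, ht, rfl⟩ := hbelow x hx
    obtain ⟨h, e⟩ := hσ' f xs ht (Fin.pos i).ne'
    rw [← e i]
    exact hw.mem_eval_arg h i

/-- A ground clause of `K` is its own instance in `K[T]`, so its terms are defined. In a non-ground
clause, flatness allows only variables as arguments, so a ground extension term is a constant. -/
theorem IsNaming.dom_extGroundTerms [Nonempty C] (hw : IsNaming (inst K (est K G) ∪ G) w y)
    (hflat : ∀ D ∈ K, IsFlat D) {t : (sig L₀ P S).Term Empty} (ht : t ∈ extGroundTerms K) :
    ((namedExt (inst K (est K G) ∪ G) w).eval Empty.elim t).Dom := by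
  obtain ⟨hext, D, hD, ht⟩ := ht
  set N := inst K (est K G) ∪ G
  by_cases hg : IsGround D
  · let σ : X → (sig L₀ P S).Term C := fun _ => .var (Classical.arbitrary C)
    have hD' : clauseSubst σ D ∈ N := Or.inl (clauseSubst_mem_inst_of_isGround hD hg _)
    have := (hw.mem_eval hD' (subst_mem_clauseTerms σ ht)).1
    rwa [relabel_elim_subst, PartialExt.eval_relabel_elim] at this
  · obtain ⟨n, f, ts, rfl⟩ := hext
    have hn : n = 0 := by
      by_contra hn
      obtain ⟨x, hx⟩ := (hflat D hD).2 hg _ ht ⟨n, f, _, rfl⟩ _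
        ⟨n, _, _, ⟨0, Nat.pos_of_ne_zero hn⟩, rfl, rfl⟩
      cases h : ts ⟨0, Nat.pos_of_ne_zero hn⟩ with
      | var x => exact x.elim
      | func g us => rw [h] at hx; cases hx
    subst hn
    exact Part.dom_iff_mem.2 ⟨_, (PartialExt.mem_eval_func _).2
      ⟨Fin.elim0, fun i => i.elim0, Part.get_mem ((namedExt N w).const_dom f _)⟩⟩

end Instances

/-! ### Completion to a total model, and the weakest constraint -/

section Main

variable {L₀ : FirstOrder.Language.{u, u}} {P S : ℕ → Type u} {C : Type u} {X : Type v}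
  {T₀ : L₀.Theory} {K : Set (Clause (sig L₀ P S) X)} {G : Set (Clause (sig L₀ P S) C)}

/-- A model of `T₀ ∪ Φ` with a naming for `K[T] ∪ G` can be completed to a model of
`T₀ ∪ Φ ∪ K ∪ G`. -/
theorem IsNaming.satWith [Finite (S 0)] [Nonempty C] {M : Type u} [Nonempty M] [L₀.Structure M]
    [(sigP L₀ P).Structure M] [(inclFun L₀ P).IsExpansionOn M] {w y : (sig L₀ P S).Term C → M}
    (hw : IsNaming (inst K (est K G) ∪ G) w y) (hN : (inst K (est K G) ∪ G).Finite)
    (hvars : ∀ D ∈ K, VarsBelowExt D) (hflat : ∀ D ∈ K, IsFlat D) (hlinear : ∀ D ∈ K, IsLinear D)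
    (hcomp : Comp T₀ K) {Φ : (sigP L₀ P).Theory} (hT₀ : M ⊨ T₀) (hΦ : M ⊨ Φ) :
    SatWith T₀ Φ K G := by
  obtain ⟨B, hfun, hrel, hext, hB⟩ := hcomp M (namedExt (inst K (est K G) ∪ G) w)
    { base := (LHom.onTheory_model _ _).2 hT₀
      weak := fun D hD => hw.weaklySatisfies fun β hβ =>
        hw.exists_subst hD (hvars D hD) (hflat D hD) (hlinear D hD) hβ
      finite := finite_dom_namedExt hN w
      ground := fun t ht => hw.dom_extGroundTerms hflat ht }
  -- The completion leaves base symbols and parameters unchanged, so `T₀` and `Φ` stay true.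
  have : (inclFun (sigP L₀ P) S).IsExpansionOn M :=
    ⟨fun f a => hfun _ f a, fun R a => propext (hrel _ R a)⟩
  rw [satWith_iff]
  refine ⟨M, inferInstance, B, fun c => w (.var c),
    model_extTheory.2 ⟨hT₀, hΦ, (model_extTheory.1 hB).2.2⟩, fun D hD => ?_⟩
  -- A literal that is defined and true in the partial structure stays true in its completion; this
  -- takes care of `G`.
  obtain ⟨l, hl, h⟩ := hw.exists_litTrue (Or.inr hD)
  exact realize_clauseFormula.2 ⟨l, hl, PartialExt.Extends.realize_of_litTrue hext h⟩

/-- By contraposition: a failure of `φ` in a model of `T₀ ∪ Φ` is precisely a naming, which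
`IsNaming.satWith` turns into a model of `T₀ ∪ Φ ∪ K ∪ G`. -/
theorem models_constraint_of_not_satWith [Finite (S 0)] [Nonempty C]
    (hN : (inst K (est K G) ∪ G).Finite)
    (hvars : ∀ D ∈ K, VarsBelowExt D) (hflat : ∀ D ∈ K, IsFlat D) (hlinear : ∀ D ∈ K, IsLinear D)
    (hcomp : Comp T₀ K) {φ : (sigP L₀ P).Sentence} (hφ : IsConstraint T₀ K G (est K G) φ)
    {Φ : (sigP L₀ P).Theory} (hΦ : ¬ SatWith T₀ Φ K G) :
    ((inclFun L₀ P).onTheory T₀ ∪ Φ) ⊨ᵇ φ := by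
  rw [Theory.models_sentence_iff]
  intro M
  let _ := (inclFun L₀ P).reduct M
  have hM := M.is_model
  rw [Theory.model_union_iff, LHom.onTheory_model] at hM
  rw [hφ.realize_iff hM.1]
  intro y w hkept hclauses
  exact hΦ (IsNaming.satWith ⟨hclauses, hkept⟩ hN hvars hflat hlinear hcomp hM.1 hM.2)

end Main

end SymbolElimination

theorem mainTheorem3 {L₀ : FirstOrder.Language.{u, u}} {P S : ℕ → Type u} [Finite (S 0)]
    {C : Type u} [Nonempty C]
    (T₀ : L₀.Theory) (hQE : SymbolElimination.HasQE T₀)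
    (K : Set (SymbolElimination.Clause (SymbolElimination.sig L₀ P S) ℕ))
    (hvars : ∀ D ∈ K, SymbolElimination.VarsBelowExt D)
    (hflat : ∀ D ∈ K, SymbolElimination.IsFlat D)
    (hlinear : ∀ D ∈ K, SymbolElimination.IsLinear D)
    (hcomp : SymbolElimination.Comp T₀ K)
    (G : Set (SymbolElimination.Clause (SymbolElimination.sig L₀ P S) C)) (hG : G.Finite)
    (hfin : (SymbolElimination.inst K (SymbolElimination.est K G)).Finite) :
    (∃ φ, SymbolElimination.IsConstraint T₀ K G (SymbolElimination.est K G) φ) ∧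
    ∀ φ, SymbolElimination.IsConstraint T₀ K G (SymbolElimination.est K G) φ →
      ¬ SymbolElimination.SatWith T₀ {φ} K G ∧
      ∀ Γ : Set (SymbolElimination.Clause (SymbolElimination.sigP L₀ P) ℕ),
        ¬ SymbolElimination.SatWith T₀ (SymbolElimination.clauseTheory Γ) K G →
        ((SymbolElimination.inclFun L₀ P).onTheory T₀ ∪ SymbolElimination.clauseTheory Γ) ⊨ᵇ φ := by
  have hN := hfin.union hG
  exact ⟨SymbolElimination.exists_isConstraint hQE hN, fun φ hφ =>
    ⟨SymbolElimination.not_satWith_constraint hφ, fun Γ hΓ =>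
      SymbolElimination.models_constraint_of_not_satWith hN hvars hflat hlinear hcomp hφ hΓ⟩⟩
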